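/- Setting. Let $N=\{1,\dots,n\}$ be a set of players. A $k$-task threshold task game ($k$-TTG) is given by an integer weight $w_i$ for each player $i$ and by $k$ tasks, each task $t$ having a threshold $q(t)\in\mathbb R$ and a payoff $V(t)\in\mathbb R$. With $w(S)=\sum_{i\in S}w_i$, the value of a coalition $S\subseteq N$ is $v(S)=\max\bigl(\{0\}\cup\{V(t): q(t)\le w(S)\}\bigr)$: the payoff of the most valuable task that $S$ can complete, where a null task of payoff $0$ is always available. Let $\mathcal C^k_{\mathrm{ttg}}$ be the class of the functions $v:2^N\to\mathbb R$ that arise in this way (for all $n$). A class $\mathcal C$ of functions $2^N\to\mathbb R$ is called (properly) PAC learnable if there are an algorithm $\mathcal A$ and a polynomial $p$ such that the following holds for every $n$ and every target $v\in\mathcal C$ on $n$ players. Given any finite sample $(S_1,v(S_1)),\dots,(S_m,v(S_m))$, the algorithm halts and outputs a function $v^*\in\mathcal C$; and for every probability distribution $\mathcal D$ on $2^N$, all $\varepsilon,\delta>0$ and every $m\ge p(n,\tfrac1\varepsilon,\tfrac1\delta)$, if $S_1,\dots,S_m$ are drawn independently from $\mathcal D$, then with probability at least $1-\delta$ $$\Pr_{S\sim\mathcal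 D}\bigl[v(S)\ne v^*(S)\bigr]<\varepsilon .$$ Here the algorithm accesses the real values $v(S_j)$ only by comparing them with each other and with $0$ and by copying them to its output as payoffs; everything else that it reads and writes (coalitions, and integer weights and thresholds) is finite data, and it computes a partial recursive function on finite data. Theorem. For every $k$, the class $\mathcal C^k_{\mathrm{ttg}}$ of $k$-TTGs is PAC learnable. The same holds for the class of $k$-TTGs whose player weights are nonnegative integers. -/

import Mathlib

/-! ### Cooperative games and threshold task games -/

/-- The characteristic function of a cooperative game with player set `{0, …, n - 1}`. -/
abbrev Game (n : ℕ) : Type := Finset (Fin n) → ℝ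

/-- A threshold task game with `n` players and `k` tasks: integer player weights, and a threshold
and a payoff for each task. -/
structure TaskGame (n k : ℕ) where
  /-- the weight of each player -/
  weight : Fin n → ℤ
  /-- the threshold of each task -/
  threshold : Fin k → ℝ
  /-- the payoff of each task -/
  payoff : Fin k → ℝ

/-- The payoffs available to the coalition `S`: those of the tasks whose threshold is at most the
total weight of `S`, together with `0`, the payoff of the null task. -/
noncomputable def TaskGame.available {n k : ℕ} (G : TaskGame n k) (S : Finset (Fin n)) :
    Finset ℝ :=
  insert 0 ((Finset.univ.filter
    fun t => G.threshold t ≤ ((∑ i ∈ S, G.weight i : ℤ) : ℝ)).image G.payoff)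

/-- The value of a coalition is the payoff of the most valuable task that it can complete. -/
noncomputable def TaskGame.value {n k : ℕ} (G : TaskGame n k) : Game n :=
  fun S => (G.available S).max' (Finset.insert_nonempty _ _)

/-- The class of `k`-task threshold task games, with arbitrary integer weights. -/
def taskGames (k n : ℕ) : Set (Game n) :=
  {v | ∃ G : TaskGame n k, G.value = v}

/-- The class of `k`-task threshold task games whose weights are nonnegative integers. -/
def nonnegTaskGames (k n : ℕ) : Set (Game n) :=
  {v | ∃ G : TaskGame n k, (∀ i, 0 ≤ G.weight i) ∧ G.value = v}

/-! ### Probability on a finite set -/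

/-- The probability of the event `E` under a distribution on a finite set, given by its
probability mass function `D`. -/
noncomputable def prob {α : Type} [Fintype α] (D : α → ℝ) (E : Set α) : ℝ :=
  open Classical in ∑ a with a ∈ E, D a

/-- The mass function of `m` independent draws from `D`. -/
noncomputable def iid {α : Type} (D : α → ℝ) (m : ℕ) : (Fin m → α) → ℝ :=
  fun x => ∏ j, D (x j)

/-! ### Samples and learners -/

/-- A sample of size `m`: observed coalitions with their values. -/
abbrev Sample (n m : ℕ) : Type := Fin m → Finset (Fin n) × ℝ

/-- The sample that shows the values of `v` on the coalitions `S 0, …, S (m - 1)`. -/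
def Game.sample {n m : ℕ} (v : Game n) (S : Fin m → Finset (Fin n)) : Sample n m :=
  fun j => (S j, v (S j))

/-- A learner maps samples to hypotheses, for every number of players and every sample size. -/
abbrev Learner : Type := (n m : ℕ) → Sample n m → Game n

/-- The learner `L` properly learns the class `C`, and `p n (1/ε) (1/δ)` samples suffice: from
samples of a game in `C` it outputs games in `C`, and for every distribution `D` of the
coalitions, with probability at least `1 - δ` over the sample, the output differs from the target
with probability less than `ε` on a fresh coalition. -/
def Learner.ProperlyLearns (L : Learner) (C : (n : ℕ) → Set (Game n))
    (p : MvPolynomial (Fin 3) ℝ) : Prop :=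
  ∀ n : ℕ, ∀ v ∈ C n,
    (∀ (m : ℕ) (S : Fin m → Finset (Fin n)), L n m (v.sample S) ∈ C n) ∧
    ∀ D ∈ stdSimplex ℝ (Finset (Fin n)), ∀ ε δ : ℝ, 0 < ε → 0 < δ →
      ∀ m : ℕ, MvPolynomial.eval ![(n : ℝ), 1 / ε, 1 / δ] p ≤ (m : ℝ) →
        1 - δ ≤ prob (iid D m)
          {S | prob D {T | v T ≠ L n m (v.sample S) T} < ε}

/-! ### Algorithms

The values in a sample are real numbers. An algorithm may compare them with each other and with
`0`, and may copy them to its output; it has no other access to them. Everything else is finite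
data, on which it has to be a partial recursive function. -/

/-- The number of entries of the list `0, v₀, …, vₘ₋₁` that are less than `vⱼ`, for `v` the values
observed in the sample. These numbers record exactly the order of the entries of that list, if
no value is negative. -/
noncomputable def Sample.rank {n m : ℕ} (s : Sample n m) (j : Fin m) : ℕ :=
  (Finset.univ.filter fun i => (s i).2 < (s j).2).card + if 0 < (s j).2 then 1 else 0

/-- What an algorithm can read of a sample: the number of players, and for each observation the
membership bits of the coalition and the rank of its value. -/
noncomputable def Sample.encode {n m : ℕ} (s : Sample n m) : ℕ × List (List Bool × ℕ) :=
  (n, List.ofFn fun j => (List.ofFn fun i => decide (i ∈ (s j).1), s.rank j))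

/-- What an algorithm writes: the list of the player weights, and a list of tasks, each with its
threshold and the number of the observation from which its payoff is copied. -/
abbrev Output : Type := List ℤ × List (ℤ × ℕ)

/-- The `j`-th observed value (`0` if there is none). -/
noncomputable def Sample.observed {n m : ℕ} (s : Sample n m) (j : ℕ) : ℝ :=
  if h : j < m then (s ⟨j, h⟩).2 else 0

/-- The game that is described by an output, where payoffs are copied from the sample `s`. -/
noncomputable def Sample.decode {n m : ℕ} (s : Sample n m) (o : Output) : Game n :=
  fun S => ((o.2.filter fun t => t.1 ≤ ∑ i ∈ S, o.1.getD i 0).map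
    fun t => s.observed t.2).foldr max 0

/-- The learner `L` is computed by an algorithm, which halts on every sample of a game in `C`. -/
def Learner.IsComputableOn (L : Learner) (C : (n : ℕ) → Set (Game n)) : Prop :=
  ∃ A : ℕ × List (List Bool × ℕ) →. Output, Partrec A ∧
    ∀ n : ℕ, ∀ v ∈ C n, ∀ (m : ℕ) (S : Fin m → Finset (Fin n)),
      ∃ o ∈ A (v.sample S).encode, L n m (v.sample S) = (v.sample S).decode o

/-- The class `C` is (properly) PAC learnable: some algorithm properly learns it from a number of
samples that is polynomial in the number of players, `1/ε` and `1/δ`. -/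
def PACLearnable (C : (n : ℕ) → Set (Game n)) : Prop :=
  ∃ (L : Learner) (p : MvPolynomial (Fin 3) ℝ), L.IsComputableOn C ∧ L.ProperlyLearns C p

/-! The learner is brute force: it enumerates all outputs and returns the first one that is
consistent with the sample. Three points make this work. The search halts
(`TaskGame.exists_output`): the target's payoffs need not occur in the sample, but values grow with
weight, so each payoff can be replaced by the value of the lightest sampled coalition completing
that task without changing any sampled value. The search is computable although values are real:
consistency can be tested on ranks alone (`Sample.fits_encode_iff`). Polynomially many samples
suffice (`one_sub_le_prob_error_lt`): real payoffs make the class infinite, but for a fixed target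
all copied payoffs lie among `0` and its at most `k + 1` values. Each task then contributes one of
these and one threshold family. Threshold families have VC dimension at most `n + 1`, so by
Sauer–Shelah there are `2 ^ O(n ^ 2)` of them, and Occam's bound applies to a finite set with
polynomial log-cardinality. -/

/-! ### Counting threshold families. -/

/-- The families of coalitions that reach some real threshold for some integer weights. -/
noncomputable def thresholdFamilies (n : ℕ) : Finset (Finset (Finset (Fin n))) :=
  open Classical in Finset.univ.filter fun F =>
    ∃ (w : Fin n → ℤ) (q : ℝ), F = Finset.univ.filter fun S => q ≤ ((∑ i ∈ S, w i : ℤ) : ℝ)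

/-- Radon's argument: more than `n + 1` indicator vectors satisfy a nontrivial affine relation `c`,
and no threshold can separate `0 ≤ c` from `c < 0`. -/
theorem card_le_of_shatters_thresholdFamilies {n : ℕ} {X : Finset (Finset (Fin n))}
    (hX : (thresholdFamilies n).Shatters X) : X.card ≤ n + 1 := by
  classical
  by_contra! hlt
  -- The extra coordinate `1` turns linear dependence into affine dependence.
  let e : Finset (Fin n) → (Option (Fin n) → ℝ) := fun S o => o.elim 1 fun i => if i ∈ S then 1 else 0
  have he : Function.Injective e := by
    intro S T h
    ext i
    have := congrFun h (some i)
    by_cases h1 : i ∈ S <;> by_cases h2 : i ∈ T <;> simp_all [e]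
  have hcard : Module.finrank ℝ (Option (Fin n) → ℝ) < (X.map ⟨e, he⟩).card := by
    simpa using hlt
  obtain ⟨f, hf, x, hx, hfx⟩ := Module.exists_nontrivial_relation_of_finrank_lt_card hcard
  rw [Finset.sum_map] at hf
  simp only [Function.Embedding.coeFn_mk] at hf
  set c : Finset (Fin n) → ℝ := fun S => f (e S) with hc
  have h1 : ∑ S ∈ X, c S = 0 := by
    have := congrFun hf none
    simpa [e, Finset.sum_apply] using this
  have h2 : ∀ i, ∑ S ∈ X, (if i ∈ S then c S else 0) = 0 := by
    intro i
    have := congrFun hf (some i)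
    simpa [e, Finset.sum_apply] using this
  obtain ⟨S₀, hS₀, rfl⟩ := Finset.mem_map.1 hx
  have hneg : ∃ S ∈ X, c S < 0 := by
    by_contra! hpos
    exact hfx ((Finset.sum_eq_zero_iff_of_nonneg hpos).1 h1 S₀ hS₀)
  obtain ⟨S₁, hS₁, hlt₁⟩ := hneg
  obtain ⟨F, hF, hFX⟩ := hX (Finset.filter_subset (fun S => 0 ≤ c S) X)
  obtain ⟨w, q, rfl⟩ := (Finset.mem_filter.1 hF).2
  have key : ∀ S ∈ X, (q ≤ ((∑ i ∈ S, w i : ℤ) : ℝ) ↔ 0 ≤ c S) := by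
    intro S hS
    have := Finset.ext_iff.1 hFX S
    simpa [hS] using this
  -- Both factors always have the same sign, strictly so at `S₁`; yet the affine relation makes the
  -- sum vanish.
  have hpos : 0 < ∑ S ∈ X, c S * (((∑ i ∈ S, w i : ℤ) : ℝ) - q) := by
    refine Finset.sum_pos' (fun S hS => ?_) ⟨S₁, hS₁, ?_⟩
    · by_cases h : 0 ≤ c S
      · exact mul_nonneg h (sub_nonneg.2 ((key S hS).2 h))
      · have := (key S hS).not.2 h
        exact mul_nonneg_of_nonpos_of_nonpos (not_le.1 h).le (by linarith)
    · have := (key S₁ hS₁).not.2 (not_le.2 hlt₁)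
      exact mul_pos_of_neg_of_neg hlt₁ (by linarith)
  have hw : ∑ S ∈ X, c S * ((∑ i ∈ S, w i : ℤ) : ℝ) = 0 := by
    have : ∀ S, c S * ((∑ i ∈ S, w i : ℤ) : ℝ) = ∑ i, (w i : ℝ) * (if i ∈ S then c S else 0) := by
      intro S
      simp [mul_comm, Finset.sum_mul]
    simp_rw [this]
    rw [Finset.sum_comm]
    simp_rw [← Finset.mul_sum, h2]
    simp
  simp_rw [mul_sub, Finset.sum_sub_distrib, ← Finset.sum_mul, h1, hw] at hpos
  simp at hpos

theorem card_thresholdFamilies_le (n : ℕ) :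
    (thresholdFamilies n).card ≤ 2 ^ (n ^ 2 + 2 * n + 2) := by
  have hd : (thresholdFamilies n).vcDim ≤ n + 1 :=
    Finset.sup_le fun X hX => card_le_of_shatters_thresholdFamilies (Finset.mem_shatterer.1 hX)
  calc (thresholdFamilies n).card
      ≤ ∑ i ∈ Finset.Iic (thresholdFamilies n).vcDim, (Fintype.card (Finset (Fin n))).choose i :=
        (Finset.card_le_card_shatterer _).trans Finset.card_shatterer_le_sum_vcDim
    _ ≤ ∑ i ∈ Finset.Iic (n + 1), (Fintype.card (Finset (Fin n))).choose i :=
        Finset.sum_le_sum_of_subset (Finset.Iic_subset_Iic.2 hd)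
    _ ≤ ∑ i ∈ Finset.Iic (n + 1), (2 ^ n) ^ (n + 1) := by
        refine Finset.sum_le_sum fun i hi => ?_
        rw [Fintype.card_finset, Fintype.card_fin]
        exact (Nat.choose_le_pow _ _).trans
          (Nat.pow_le_pow_right (Nat.two_pow_pos n) (Finset.mem_Iic.1 hi))
    _ = (n + 2) * (2 ^ n) ^ (n + 1) := by simp
    _ ≤ 2 ^ (n + 2) * (2 ^ n) ^ (n + 1) := by
        gcongr
        exact Nat.lt_two_pow_self.le
    _ = 2 ^ (n ^ 2 + 2 * n + 2) := by ring

/-! ### Finite probability and Occam's bound. -/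

section FiniteProbability

theorem iid_nonneg {α : Type} {D : α → ℝ} (hD : ∀ a, 0 ≤ D a) (m : ℕ) (x : Fin m → α) :
    0 ≤ iid D m x :=
  Finset.prod_nonneg fun _ _ => hD _

variable {α : Type} [Fintype α]

theorem prob_mono {D : α → ℝ} (hD : ∀ a, 0 ≤ D a) {E F : Set α} (h : E ⊆ F) :
    prob D E ≤ prob D F := by
  classical
  unfold prob
  exact Finset.sum_le_sum_of_subset_of_nonneg
    (fun a ha => by simpa using h (by simpa using ha)) fun a _ _ => hD a

theorem prob_add_prob_compl (D : α → ℝ) (E : Set α) : prob D E + prob D Eᶜ = ∑ a, D a := by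
  classical
  unfold prob
  simpa using Finset.sum_filter_add_sum_filter_not Finset.univ (· ∈ E) D

theorem prob_biUnion_le {ι : Type*} {D : α → ℝ} (hD : ∀ a, 0 ≤ D a) (H : Finset ι)
    (E : ι → Set α) : prob D (⋃ h ∈ H, E h) ≤ ∑ h ∈ H, prob D (E h) := by
  classical
  simp only [prob, Finset.sum_filter]
  rw [Finset.sum_comm]
  refine Finset.sum_le_sum fun a _ => ?_
  have hs : ∀ h ∈ H, 0 ≤ if a ∈ E h then D a else 0 := fun h _ => by
    split_ifs
    exacts [hD a, le_rfl]
  split_ifs with ha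
  · obtain ⟨h, hH, hE⟩ := Set.mem_iUnion₂.1 ha
    simpa [hE] using Finset.single_le_sum hs hH
  · exact Finset.sum_nonneg hs

theorem sum_iid (D : α → ℝ) (m : ℕ) : ∑ x, iid D m x = (∑ a, D a) ^ m := by
  classical
  unfold iid
  rw [← Fintype.piFinset_univ, ← Finset.prod_univ_sum]
  simp

theorem prob_iid_forall_mem (D : α → ℝ) (m : ℕ) (E : Set α) :
    prob (iid D m) {x | ∀ j, x j ∈ E} = prob D E ^ m := by
  classical
  unfold prob iid
  have : (Finset.univ.filter fun x : Fin m → α => x ∈ {x : Fin m → α | ∀ j, x j ∈ E}) =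
      Fintype.piFinset fun _ => Finset.univ.filter fun a => a ∈ E := by
    ext x
    simp
  calc _ = ∑ x ∈ Fintype.piFinset fun _ : Fin m => Finset.univ.filter fun a => a ∈ E,
        ∏ j, D (x j) := by rw [← this]; congr!
    _ = _ := by
        rw [← Finset.prod_univ_sum]
        simp

/-- Occam's bound for a consistent learner with a finite set `H` of hypotheses. -/
theorem one_sub_le_prob_error_lt {β : Type*} {D : α → ℝ} (hD : D ∈ stdSimplex ℝ α)
    (f : α → β) (H : Finset (α → β)) {m : ℕ} (L : (Fin m → α) → α → β)
    (hLH : ∀ x, L x ∈ H) (hL : ∀ x j, L x (x j) = f (x j)) {ε δ K : ℝ} (hε : 0 < ε) (hδ : 0 < δ)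
    (hK : (H.card : ℝ) ≤ Real.exp K) (hm : 1 / ε * (K + 1 / δ) ≤ m) :
    1 - δ ≤ prob (iid D m) {x | prob D {a | f a ≠ L x a} < ε} := by
  classical
  have h0 := iid_nonneg hD.1 m
  set good : Set (Fin m → α) := {x | prob D {a | f a ≠ L x a} < ε}
  have htot : prob (iid D m) good + prob (iid D m) goodᶜ = 1 := by
    rw [prob_add_prob_compl, sum_iid, hD.2, one_pow]
  let bad := H.filter fun h => ε ≤ prob D {a | f a ≠ h a}
  -- A failing output still agrees with `f` on the whole sample, so some fixed bad hypothesis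
  -- survived all `m` draws.
  have hsub : goodᶜ ⊆ ⋃ h ∈ bad, {x | ∀ j, x j ∈ {a | f a ≠ h a}ᶜ} := by
    intro x hx
    simp only [Set.mem_iUnion]
    refine ⟨L x, Finset.mem_filter.2 ⟨hLH x, not_lt.1 hx⟩, fun j => ?_⟩
    simp [hL]
  have hbound : ∀ h ∈ bad,
      prob (iid D m) {x | ∀ j, x j ∈ {a | f a ≠ h a}ᶜ} ≤ Real.exp (-(K + 1 / δ)) := by
    intro h hh
    rw [prob_iid_forall_mem]
    have h1 := prob_add_prob_compl D {a | f a ≠ h a}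
    rw [hD.2] at h1
    have h2 : ε ≤ prob D {a | f a ≠ h a} := (Finset.mem_filter.1 hh).2
    have h3 : 0 ≤ prob D {a | f a ≠ h a}ᶜ := by
      unfold prob
      exact Finset.sum_nonneg fun a _ => hD.1 a
    have h4 : prob D {a | f a ≠ h a}ᶜ ≤ Real.exp (-ε) := by
      have := Real.add_one_le_exp (-ε)
      linarith
    calc _ ≤ Real.exp (-ε) ^ m := pow_le_pow_left₀ h3 h4 m
      _ = Real.exp (-(ε * m)) := by rw [← Real.exp_nat_mul]; ring_nf
      _ ≤ _ := by
        refine Real.exp_le_exp.2 (neg_le_neg ?_)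
        rw [one_div_mul_eq_div, div_le_iff₀ hε] at hm
        linarith
  have hbad : prob (iid D m) goodᶜ ≤ δ :=
    calc _ ≤ _ := prob_mono h0 hsub
      _ ≤ ∑ h ∈ bad, _ := prob_biUnion_le h0 _ _
      _ ≤ ∑ h ∈ bad, Real.exp (-(K + 1 / δ)) := Finset.sum_le_sum hbound
      _ = bad.card * Real.exp (-(K + 1 / δ)) := by simp
      _ ≤ Real.exp K * Real.exp (-(K + 1 / δ)) := by
        gcongr
        exact le_trans (by exact_mod_cast Finset.card_filter_le _ _) hK
      _ = (Real.exp (1 / δ))⁻¹ := by rw [← Real.exp_add, ← Real.exp_neg]; ring_nf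
      -- The cruder `1 / δ` in place of `log (1 / δ)` keeps the sample bound polynomial.
      _ ≤ (1 / δ)⁻¹ := by
        gcongr
        have := Real.add_one_le_exp (1 / δ)
        linarith
      _ = δ := by simp
  linarith

end FiniteProbability

/-! ### Computability of the search. -/

/-- The code of `a ≥ 0` is `2 * a` and that of `-(a + 1)` is `2 * a + 1`, so parity gives the sign
and halving the size. -/
theorem Int.primrec_toNat : Primrec Int.toNat := by
  refine (Primrec.ite (PrimrecPred.comp (p := fun m : ℕ => m % 2 = 0) (f := Encodable.encode)
    (Primrec.eq.comp (Primrec.nat_mod.comp .id (.const 2)) (.const 0)) Primrec.encode)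
    (Primrec.nat_div.comp Primrec.encode (.const 2)) (.const 0)).of_eq fun z => ?_
  rcases z with a | a
  · have : Encodable.encode (Int.ofNat a) = 2 * a := rfl
    rw [this]; simp
  · have : Encodable.encode (Int.negSucc a) = 2 * a + 1 := rfl
    rw [this]; simp [Nat.add_mod]

theorem Int.primrec_neg_toNat : Primrec fun z : ℤ => (-z).toNat := by
  refine (Primrec.ite (PrimrecPred.comp (p := fun m : ℕ => m % 2 = 0) (f := Encodable.encode)
    (Primrec.eq.comp (Primrec.nat_mod.comp .id (.const 2)) (.const 0)) Primrec.encode)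
    (.const 0) (Primrec.succ.comp (Primrec.nat_div.comp Primrec.encode (.const 2)))).of_eq
    fun z => ?_
  rcases z with a | a
  · have : Encodable.encode (Int.ofNat a) = 2 * a := rfl
    rw [this]; simp
  · have : Encodable.encode (Int.negSucc a) = 2 * a + 1 := rfl
    rw [this, if_neg (by omega), Int.neg_negSucc]
    simp; omega

/-- The sum over the positions `i < n` set in `bits` of the values of `g` at the weights. -/
def weightSum (g : ℤ → ℕ) (n : ℕ) (bits : List Bool) (w : List ℤ) : ℕ :=
  (List.range n).foldr (fun i acc => (if bits.getD i false = true then g (w.getD i 0) else 0)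
    + acc) 0

theorem primrec_weightSum {α : Type*} [Primcodable α] {g : ℤ → ℕ} (hg : Primrec g) {n : α → ℕ}
    {b : α → List Bool} {w : α → List ℤ} (hn : Primrec n) (hb : Primrec b) (hw : Primrec w) :
    Primrec fun a => weightSum g (n a) (b a) (w a) := by
  refine Primrec.list_foldr (h := fun a p => (if (b a).getD p.1 false = true then
    g ((w a).getD p.1 0) else 0) + p.2) (Primrec.list_range.comp hn) (.const 0) ?_
  have h1 : Primrec fun x : α × ℕ × ℕ => x.2.1 := Primrec.fst.comp Primrec.snd
  refine Primrec.nat_add.comp (Primrec.ite (Primrec.eq.comp ((Primrec.list_getD false).comp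
    (hb.comp .fst) h1) (.const true)) (hg.comp ((Primrec.list_getD 0).comp (hw.comp .fst) h1))
    (.const 0)) (Primrec.snd.comp .snd)

/-- Whether a coalition, given by its membership bits, reaches the threshold `q`; the integers are
split into their positive and negative parts. -/
def Reaches (n : ℕ) (bits : List Bool) (w : List ℤ) (q : ℤ) : Prop :=
  q.toNat + weightSum (fun z => (-z).toNat) n bits w ≤ (-q).toNat + weightSum Int.toNat n bits w

instance (n : ℕ) (bits : List Bool) (w : List ℤ) (q : ℤ) : Decidable (Reaches n bits w q) :=
  inferInstanceAs (Decidable (_ ≤ _))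

/-- The rank of the payoff that the output `o` yields for a coalition given by its bits. -/
def predictedRank (a : ℕ × List (List Bool × ℕ)) (o : Output) (bits : List Bool) : ℕ :=
  o.2.foldr (fun t acc =>
    if Reaches a.1 bits o.1 t.1 then max ((a.2.map Prod.snd).getD t.2 0) acc else acc) 0

theorem primrec_predictedRank : Primrec fun x : (ℕ × List (List Bool × ℕ)) × Output × List Bool =>
    predictedRank x.1 x.2.1 x.2.2 := by
  refine Primrec.list_foldr
    (h := fun (x : (ℕ × List (List Bool × ℕ)) × Output × List Bool) (p : (ℤ × ℕ) × ℕ) =>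
      if Reaches x.1.1 x.2.2 x.2.1.1 p.1.1 then
        max ((x.1.2.map Prod.snd).getD p.1.2 0) p.2 else p.2)
    (Primrec.snd.comp (Primrec.fst.comp .snd)) (.const 0) ?_
  have hq : Primrec fun y : ((ℕ × List (List Bool × ℕ)) × Output × List Bool) × (ℤ × ℕ) × ℕ =>
      y.2.1.1 := Primrec.fst.comp (Primrec.fst.comp .snd)
  have hn : Primrec fun y : ((ℕ × List (List Bool × ℕ)) × Output × List Bool) × (ℤ × ℕ) × ℕ =>
      y.1.1.1 := Primrec.fst.comp (Primrec.fst.comp .fst)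
  have hb : Primrec fun y : ((ℕ × List (List Bool × ℕ)) × Output × List Bool) × (ℤ × ℕ) × ℕ =>
      y.1.2.2 := Primrec.snd.comp (Primrec.snd.comp .fst)
  have hw : Primrec fun y : ((ℕ × List (List Bool × ℕ)) × Output × List Bool) × (ℤ × ℕ) × ℕ =>
      y.1.2.1.1 := Primrec.fst.comp (Primrec.fst.comp (Primrec.snd.comp .fst))
  refine Primrec.ite ?_ ?_ (Primrec.snd.comp .snd)
  · exact Primrec.nat_le.comp
      (Primrec.nat_add.comp (Int.primrec_toNat.comp hq)
        (primrec_weightSum Int.primrec_neg_toNat hn hb hw))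
      (Primrec.nat_add.comp (Int.primrec_neg_toNat.comp hq)
        (primrec_weightSum Int.primrec_toNat hn hb hw))
  · refine Primrec.nat_max.comp ((Primrec.list_getD 0).comp ?_ ?_) (Primrec.snd.comp .snd)
    · exact Primrec.list_map (Primrec.snd.comp (Primrec.fst.comp .fst))
        (Primrec.snd.comp .snd).to₂
    · exact Primrec.snd.comp (Primrec.fst.comp .snd)

/-- The output `o` has `k` tasks, its weights are nonnegative if `pos` is set, and the ranks it
predicts are those in the encoded sample `a`. -/
def Fits (k : ℕ) (pos : Bool) (a : ℕ × List (List Bool × ℕ)) (o : Output) : Prop :=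
  (o.2.length = k ∧ (pos = false ∨ ∀ z ∈ o.1, (-z).toNat = 0)) ∧
    ∀ e ∈ a.2, predictedRank a o e.1 = e.2

instance (k : ℕ) (pos : Bool) (a : ℕ × List (List Bool × ℕ)) (o : Output) :
    Decidable (Fits k pos a o) :=
  inferInstanceAs (Decidable (_ ∧ _))

theorem primrecRel_fits (k : ℕ) (pos : Bool) : PrimrecRel (Fits k pos) := by
  refine PrimrecPred.and (PrimrecPred.and ?_ (PrimrecPred.or ?_ ?_)) ?_
  · exact Primrec.eq.comp (Primrec.list_length.comp (Primrec.snd.comp .snd)) (.const k)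
  · exact Primrec.eq.comp (.const pos) (.const false)
  · exact PrimrecPred.comp (p := fun l : List ℤ => ∀ z ∈ l, (-z).toNat = 0)
      (PrimrecPred.forall_mem_list (Primrec.eq.comp Int.primrec_neg_toNat (.const 0)))
      (Primrec.fst.comp .snd)
  · have : PrimrecRel fun (e : List Bool × ℕ) (x : (ℕ × List (List Bool × ℕ)) × Output) =>
        predictedRank x.1 x.2 e.1 = e.2 :=
      Primrec.eq.comp (primrec_predictedRank.comp (Primrec.pair (Primrec.fst.comp .snd)
        (Primrec.pair (Primrec.snd.comp .snd) (Primrec.fst.comp .fst)))) (Primrec.snd.comp .fst)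
    exact this.forall_mem_list.comp (Primrec.snd.comp .fst) .id

/-- The search for an output that fits the encoded sample. -/
def searchFit (k : ℕ) (pos : Bool) (a : ℕ × List (List Bool × ℕ)) : Part Output :=
  Nat.rfindOpt fun c => (Encodable.decode (α := Output) c).bind fun o =>
    if Fits k pos a o then some o else none

theorem partrec_searchFit (k : ℕ) (pos : Bool) : Partrec (searchFit k pos) := by
  refine Partrec.rfindOpt (Primrec.to_comp ?_)
  refine Primrec.option_bind (Primrec.decode.comp .snd)
    (Primrec.ite ?_ (Primrec.option_some.comp .snd) (.const none))
  exact (primrecRel_fits k pos).comp (Primrec.fst.comp .fst) .snd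

theorem fits_of_mem_searchFit {k : ℕ} {pos : Bool} {a : ℕ × List (List Bool × ℕ)} {o : Output}
    (h : o ∈ searchFit k pos a) : Fits k pos a o := by
  obtain ⟨c, hc⟩ := Nat.rfindOpt_spec h
  obtain ⟨o', -, h'⟩ := Option.bind_eq_some_iff.1 hc
  split_ifs at h' with hf
  exact Option.some.inj h' ▸ hf

theorem exists_mem_searchFit {k : ℕ} {pos : Bool} {a : ℕ × List (List Bool × ℕ)} {o : Output}
    (h : Fits k pos a o) : ∃ o', o' ∈ searchFit k pos a := by
  refine Part.dom_iff_mem.1 (Nat.rfindOpt_dom.2 ⟨Encodable.encode o, o, ?_⟩)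
  rw [Encodable.encodek]
  simp [h]

/-! ### Outputs as task games. -/

theorem List.foldr_max_zero_le_iff {α : Type*} [LinearOrder α] [Zero α] {l : List α} {c : α} :
    l.foldr max 0 ≤ c ↔ 0 ≤ c ∧ ∀ a ∈ l, a ≤ c := by
  induction l with
  | nil => simp
  | cons a l ih =>
    simp only [List.foldr_cons, max_le_iff, ih, List.mem_cons, forall_eq_or_imp]
    tauto

theorem List.foldr_max_zero_mem {α : Type*} [LinearOrder α] [Zero α] (l : List α) :
    l.foldr max 0 = 0 ∨ l.foldr max 0 ∈ l := by
  induction l with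
  | nil => simp
  | cons a l ih =>
    rw [List.foldr_cons]
    rcases max_choice a (l.foldr max 0) with h | h <;> rw [h]
    · simp
    · rcases ih with h | h
      · exact .inl h
      · exact .inr (List.mem_cons_of_mem _ h)

theorem TaskGame.value_le_iff {n k : ℕ} {G : TaskGame n k} {S : Finset (Fin n)} {c : ℝ} :
    G.value S ≤ c ↔ 0 ≤ c ∧
      ∀ t, G.threshold t ≤ ((∑ i ∈ S, G.weight i : ℤ) : ℝ) → G.payoff t ≤ c := by
  simp [TaskGame.value, TaskGame.available, Finset.max'_le_iff]

theorem TaskGame.value_nonneg {n k : ℕ} (G : TaskGame n k) (S : Finset (Fin n)) :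
    0 ≤ G.value S :=
  (TaskGame.value_le_iff.1 le_rfl).1

theorem TaskGame.value_eq_zero_or {n k : ℕ} (G : TaskGame n k) (S : Finset (Fin n)) :
    G.value S = 0 ∨
      ∃ t, G.threshold t ≤ ((∑ i ∈ S, G.weight i : ℤ) : ℝ) ∧ G.payoff t = G.value S := by
  have := Finset.max'_mem (G.available S) (Finset.insert_nonempty _ _)
  change G.value S ∈ G.available S at this
  simpa [TaskGame.available] using this

theorem TaskGame.value_mono {n k : ℕ} (G : TaskGame n k) {S T : Finset (Fin n)}
    (h : ∑ i ∈ S, G.weight i ≤ ∑ i ∈ T, G.weight i) : G.value S ≤ G.value T := by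
  refine TaskGame.value_le_iff.2 ⟨G.value_nonneg T, fun t ht => ?_⟩
  exact (TaskGame.value_le_iff.1 le_rfl).2 t (ht.trans (by exact_mod_cast h))

theorem Sample.decode_le_iff {n m : ℕ} {s : Sample n m} {o : Output} {S : Finset (Fin n)} {c : ℝ} :
    s.decode o S ≤ c ↔
      0 ≤ c ∧ ∀ t ∈ o.2, t.1 ≤ ∑ i ∈ S, o.1.getD i 0 → s.observed t.2 ≤ c := by
  rw [Sample.decode, List.foldr_max_zero_le_iff]
  simp only [List.mem_map, List.mem_filter, decide_eq_true_eq]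
  constructor
  · exact fun h => ⟨h.1, fun t ht h' => h.2 _ ⟨t, ⟨ht, h'⟩, rfl⟩⟩
  · rintro ⟨h, h'⟩
    refine ⟨h, ?_⟩
    rintro _ ⟨t, ⟨ht, h''⟩, rfl⟩
    exact h' t ht h''

/-- The task game that is described by an output with `k` tasks. -/
noncomputable def Sample.taskGame {n m k : ℕ} (s : Sample n m) (o : Output) (h : o.2.length = k) :
    TaskGame n k where
  weight i := o.1.getD i 0
  threshold t := ((o.2.get (t.cast h.symm)).1 : ℝ)
  payoff t := s.observed (o.2.get (t.cast h.symm)).2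

theorem Sample.value_taskGame {n m k : ℕ} (s : Sample n m) (o : Output) (h : o.2.length = k) :
    (s.taskGame o h).value = s.decode o := by
  subst h
  funext S
  refine eq_of_forall_ge_iff fun c => ?_
  rw [TaskGame.value_le_iff, Sample.decode_le_iff]
  refine and_congr_right fun _ => ?_
  simp only [Sample.taskGame, Int.cast_le, Fin.cast_eq_self, List.forall_mem_iff_get]

theorem weightSum_ofFn (g : ℤ → ℕ) {n : ℕ} (S : Finset (Fin n)) (w : List ℤ) :
    weightSum g n (List.ofFn fun i => decide (i ∈ S)) w = ∑ i ∈ S, g (w.getD i 0) := by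
  have h : ∀ (f : ℕ → ℕ) (l : List ℕ), l.foldr (fun i acc => f i + acc) 0 = (l.map f).sum := by
    intro f l
    induction l <;> simp_all
  have h' : ∀ f : ℕ → ℕ, ((List.range n).map f).sum = ∑ i ∈ Finset.range n, f i := fun _ => rfl
  rw [weightSum, h, h', Finset.sum_range]
  simp [List.getD_eq_getElem?_getD, Finset.sum_ite_mem]

theorem reaches_iff {n : ℕ} {S : Finset (Fin n)} {w : List ℤ} {q : ℤ} :
    Reaches n (List.ofFn fun i => decide (i ∈ S)) w q ↔ q ≤ ∑ i ∈ S, w.getD i 0 := by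
  have h : ∑ i ∈ S, w.getD i 0 =
      ((∑ i ∈ S, (w.getD i 0).toNat : ℕ) : ℤ) - ((∑ i ∈ S, (-w.getD i 0).toNat : ℕ) : ℤ) := by
    push_cast
    rw [← Finset.sum_sub_distrib]
    exact Finset.sum_congr rfl fun i _ => by omega
  rw [Reaches, weightSum_ofFn, weightSum_ofFn, h]
  omega

/-! ### Ranks in place of real values. -/

/-- The number of entries of the list `0, v₀, …, vₘ₋₁` that are less than `x`, for `v` the observed
values, all assumed nonnegative. -/
noncomputable def Sample.rankOf {n m : ℕ} (s : Sample n m) (x : ℝ) : ℕ :=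
  (Finset.univ.filter fun i => (s i).2 < x).card + if 0 < x then 1 else 0

theorem Sample.rankOf_mono {n m : ℕ} (s : Sample n m) : Monotone s.rankOf := by
  intro x y h
  unfold Sample.rankOf
  refine add_le_add (Finset.card_le_card fun i hi => ?_) ?_
  · simp only [Finset.mem_filter_univ] at hi ⊢
    exact hi.trans_le h
  · split_ifs <;> first | omega | (exfalso; linarith)

theorem Sample.rankOf_zero {n m : ℕ} {s : Sample n m} (hs : ∀ i, 0 ≤ (s i).2) :
    s.rankOf 0 = 0 := by
  simp [Sample.rankOf, hs]

/-- The entry `x` of the list is itself counted for `y` but not for `x`; if `x = 0`, the indicator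
term does this. -/
theorem Sample.rankOf_lt {n m : ℕ} {s : Sample n m} {x y : ℝ} (hx : x = 0 ∨ ∃ i, (s i).2 = x)
    (h : x < y) : s.rankOf x < s.rankOf y := by
  have hsub : (Finset.univ.filter fun i => (s i).2 < x) ⊆
      Finset.univ.filter fun i => (s i).2 < y := fun i hi => by
    simp only [Finset.mem_filter_univ] at hi ⊢
    exact hi.trans h
  unfold Sample.rankOf
  rcases hx with rfl | ⟨i, rfl⟩
  · have := Finset.card_le_card hsub
    simp only [lt_self_iff_false, if_false, h, if_true]
    omega
  · refine add_lt_add_of_lt_of_le (Finset.card_lt_card ⟨hsub, fun hc => ?_⟩) ?_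
    · have := hc (Finset.mem_filter.2 ⟨Finset.mem_univ i, h⟩)
      simp at this
    · split_ifs <;> first | omega | (exfalso; linarith)

theorem Sample.rankOf_inj {n m : ℕ} {s : Sample n m} {x y : ℝ} (hx : x = 0 ∨ ∃ i, (s i).2 = x)
    (hy : y = 0 ∨ ∃ i, (s i).2 = y) : s.rankOf x = s.rankOf y ↔ x = y := by
  refine ⟨fun h => ?_, fun h => h ▸ rfl⟩
  rcases lt_trichotomy x y with h' | h' | h'
  · exact absurd h (Sample.rankOf_lt hx h').ne
  · exact h'
  · exact absurd h (Sample.rankOf_lt hy h').ne'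

theorem Sample.observed_eq_zero_or {n m : ℕ} (s : Sample n m) (j : ℕ) :
    s.observed j = 0 ∨ ∃ i, (s i).2 = s.observed j := by
  unfold Sample.observed
  split_ifs with h
  · exact .inr ⟨_, rfl⟩
  · exact .inl rfl

theorem Sample.decode_eq_zero_or {n m : ℕ} (s : Sample n m) (o : Output) (S : Finset (Fin n)) :
    s.decode o S = 0 ∨ ∃ i, (s i).2 = s.decode o S := by
  rcases List.foldr_max_zero_mem ((o.2.filter fun t => t.1 ≤ ∑ i ∈ S, o.1.getD i 0).map
    fun t => s.observed t.2) with h | h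
  · exact .inl h
  · obtain ⟨t, -, ht⟩ := List.mem_map.1 h
    change s.observed t.2 = s.decode o S at ht
    exact ht ▸ s.observed_eq_zero_or t.2

theorem Sample.getD_encode {n m : ℕ} {s : Sample n m} (hs : ∀ i, 0 ≤ (s i).2) (j : ℕ) :
    (s.encode.2.map Prod.snd).getD j 0 = s.rankOf (s.observed j) := by
  rw [Sample.encode, List.map_ofFn, List.getD_eq_getElem?_getD]
  by_cases h : j < m
  · simp [h, Sample.observed, Sample.rankOf, Sample.rank]
  -- Past the end of the sample both defaults are `0`, and `0` has rank `0` because no value is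
  -- negative.
  · simp [h, Sample.observed, Sample.rankOf_zero hs]

/-- Being monotone and sending `0` to `0`, `rankOf` commutes with the fold of `max`. -/
theorem Sample.predictedRank_eq {n m : ℕ} {s : Sample n m} (hs : ∀ i, 0 ≤ (s i).2) (o : Output)
    (S : Finset (Fin n)) :
    predictedRank s.encode o (List.ofFn fun i => decide (i ∈ S)) = s.rankOf (s.decode o S) := by
  unfold predictedRank Sample.decode
  simp_rw [Sample.getD_encode hs]
  have hn : s.encode.1 = n := rfl
  rw [hn]
  simp_rw [reaches_iff]
  induction o.2 with
  | nil => simp [Sample.rankOf_zero hs]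
  | cons t l ih =>
    rw [List.foldr_cons, ih]
    by_cases h : t.1 ≤ ∑ i ∈ S, o.1.getD i 0
    · rw [if_pos h, List.filter_cons_of_pos (by simpa using h), List.map_cons, List.foldr_cons,
        s.rankOf_mono.map_max]
    · rw [if_neg h, List.filter_cons_of_neg (by simpa using h)]

theorem Sample.fits_encode_iff {n m k : ℕ} {pos : Bool} {s : Sample n m} (hs : ∀ i, 0 ≤ (s i).2)
    {o : Output} : Fits k pos s.encode o ↔
      (o.2.length = k ∧ (pos = false ∨ ∀ z ∈ o.1, 0 ≤ z)) ∧ ∀ j, s.decode o (s j).1 = (s j).2 := by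
  unfold Fits
  refine and_congr ?_ ?_
  · simp [Int.toNat_eq_zero]
  · have he : s.encode.2 =
        List.ofFn fun j => (List.ofFn fun i => decide (i ∈ (s j).1), s.rank j) := rfl
    rw [he, List.forall_mem_ofFn_iff]
    refine forall_congr' fun j => ?_
    rw [Sample.predictedRank_eq hs]
    exact Sample.rankOf_inj (s.decode_eq_zero_or o _) (.inr ⟨j, rfl⟩)

theorem TaskGame.exists_output {n k m : ℕ} (G : TaskGame n k) (S : Fin m → Finset (Fin n)) :
    ∃ o : Output, o.1 = List.ofFn G.weight ∧ o.2.length = k ∧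
      ∀ j, (G.value.sample S).decode o (S j) = G.value (S j) := by
  have hidx : ∀ t, ∃ a : ℕ,
      (∀ j, G.threshold t ≤ ((∑ i ∈ S j, G.weight i : ℤ) : ℝ) →
        G.payoff t ≤ (G.value.sample S).observed a ∧
          (G.value.sample S).observed a ≤ G.value (S j)) := by
    intro t
    by_cases hne : ∃ j, G.threshold t ≤ ((∑ i ∈ S j, G.weight i : ℤ) : ℝ)
    · obtain ⟨j₀, hj₀⟩ := hne
      -- The lightest sampled coalition that completes `t`: its value is at least the payoff of `t`
      -- and at most that of every sampled coalition completing `t`.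
      obtain ⟨a, ha, hmin⟩ := (Finset.univ.filter fun j =>
        G.threshold t ≤ ((∑ i ∈ S j, G.weight i : ℤ) : ℝ)).exists_min_image
          (fun j => ∑ i ∈ S j, G.weight i) ⟨j₀, by simpa using hj₀⟩
      refine ⟨a, fun j hj => ?_⟩
      have hobs : (G.value.sample S).observed a = G.value (S a) := by
        simp [Sample.observed, Game.sample]
      rw [hobs]
      exact ⟨(TaskGame.value_le_iff.1 le_rfl).2 t (Finset.mem_filter.1 ha).2,
        G.value_mono (hmin j (Finset.mem_filter.2 ⟨Finset.mem_univ j, hj⟩))⟩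
    -- No sampled coalition completes `t`, so any index will do.
    · exact ⟨0, fun j hj => absurd ⟨j, hj⟩ hne⟩
  choose a ha using hidx
  -- Weights are integers, so rounding a threshold up changes nothing.
  refine ⟨(List.ofFn G.weight, List.ofFn fun t => (⌈G.threshold t⌉, a t)), rfl, by simp,
    fun j => ?_⟩
  have hw : ∑ i ∈ S j, (List.ofFn G.weight).getD i 0 = ∑ i ∈ S j, G.weight i :=
    Finset.sum_congr rfl fun i _ => by simp [List.getD_eq_getElem?_getD]
  apply le_antisymm
  · rw [Sample.decode_le_iff]
    refine ⟨G.value_nonneg _, (List.forall_mem_ofFn_iff).2 fun t ht => ?_⟩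
    rw [hw, Int.ceil_le] at ht
    exact (ha t j ht).2
  · have h0 := Sample.decode_le_iff.1 (le_refl ((G.value.sample S).decode
      (List.ofFn G.weight, List.ofFn fun t => (⌈G.threshold t⌉, a t)) (S j)))
    refine TaskGame.value_le_iff.2 ⟨h0.1, fun t ht => (ha t j ht).1.trans ?_⟩
    exact (List.forall_mem_ofFn_iff).1 h0.2 t (by rwa [hw, Int.ceil_le])

/-! ### The learner and its finite set of hypotheses. -/

/-- The task games with `k` tasks, with nonnegative weights if `pos` is set. -/
def signedTaskGames (k : ℕ) (pos : Bool) (n : ℕ) : Set (Game n) :=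
  {v | ∃ G : TaskGame n k, (pos = false ∨ ∀ i, 0 ≤ G.weight i) ∧ G.value = v}

/-- The learner that outputs the first task game in an enumeration that is consistent with the
sample. -/
noncomputable def consistentLearner (k : ℕ) (pos : Bool) : Learner := fun _ _ s =>
  open Classical in
  if h : ∃ o, o ∈ searchFit k pos s.encode then s.decode h.choose else 0

theorem exists_consistentLearner_eq {k n m : ℕ} {pos : Bool} {v : Game n}
    (hv : v ∈ signedTaskGames k pos n) (S : Fin m → Finset (Fin n)) :
    ∃ o ∈ searchFit k pos (v.sample S).encode,
      consistentLearner k pos n m (v.sample S) = (v.sample S).decode o ∧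
      Fits k pos (v.sample S).encode o := by
  obtain ⟨G, hG, rfl⟩ := hv
  have hs : ∀ i, 0 ≤ (G.value.sample S i).2 := fun i => G.value_nonneg _
  obtain ⟨o, ho1, ho2, ho⟩ := G.exists_output S
  have hfit : Fits k pos (G.value.sample S).encode o :=
    (Sample.fits_encode_iff hs).2 ⟨⟨ho2, hG.imp_right fun h => by
      rw [ho1]; exact List.forall_mem_ofFn_iff.2 h⟩, ho⟩
  have hex := exists_mem_searchFit hfit
  exact ⟨hex.choose, hex.choose_spec, dif_pos hex, fits_of_mem_searchFit hex.choose_spec⟩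

/-- The functions that are values of task games with `k` tasks and payoffs in `R`. -/
noncomputable def taskGamesWithPayoffs (n k : ℕ) (R : Finset ℝ) : Finset (Game n) :=
  open Classical in
  -- The families of different tasks need not share weights; this larger set is still small enough.
  ((Fintype.piFinset fun _ : Fin k => thresholdFamilies n) ×ˢ
    Fintype.piFinset fun _ : Fin k => R).image fun x S =>
      (insert 0 ((Finset.univ.filter fun t => S ∈ x.1 t).image x.2)).max' (Finset.insert_nonempty _ _)

theorem TaskGame.value_mem_taskGamesWithPayoffs {n k : ℕ} {R : Finset ℝ} (G : TaskGame n k)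
    (hR : ∀ t, G.payoff t ∈ R) : G.value ∈ taskGamesWithPayoffs n k R := by
  classical
  refine Finset.mem_image.2 ⟨(fun t => Finset.univ.filter fun S =>
    G.threshold t ≤ ((∑ i ∈ S, G.weight i : ℤ) : ℝ), G.payoff), ?_, ?_⟩
  · simp only [Finset.mem_product, Fintype.mem_piFinset]
    exact ⟨fun t => Finset.mem_filter.2 ⟨Finset.mem_univ _, G.weight, G.threshold t, by congr!⟩, hR⟩
  · funext S
    unfold TaskGame.value TaskGame.available
    congr!
    simp

theorem card_taskGamesWithPayoffs_le {n k : ℕ} {R : Finset ℝ} (hR : R.card ≤ k + 1) :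
    ((taskGamesWithPayoffs n k R).card : ℝ) ≤
      Real.exp (k * ((n : ℝ) ^ 2 + 2 * n + 2) + (k : ℝ) ^ 2) := by
  have h1 : (taskGamesWithPayoffs n k R).card ≤ (2 ^ (n ^ 2 + 2 * n + 2)) ^ k * (k + 1) ^ k := by
    refine Finset.card_image_le.trans ?_
    rw [Finset.card_product, Fintype.card_piFinset_const, Fintype.card_piFinset_const]
    exact Nat.mul_le_mul (Nat.pow_le_pow_left (card_thresholdFamilies_le n) k)
      (Nat.pow_le_pow_left hR k)
  have h2 : (2 : ℝ) ≤ Real.exp 1 := by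
    have := Real.add_one_le_exp 1
    linarith
  calc ((taskGamesWithPayoffs n k R).card : ℝ)
      ≤ (2 ^ (n ^ 2 + 2 * n + 2)) ^ k * ((k : ℝ) + 1) ^ k := by exact_mod_cast h1
    _ ≤ (Real.exp 1 ^ (n ^ 2 + 2 * n + 2)) ^ k * Real.exp k ^ k := by
        gcongr
        exact Real.add_one_le_exp _
    _ = _ := by
        rw [← Real.exp_nat_mul, ← Real.exp_nat_mul, ← Real.exp_nat_mul, ← Real.exp_add]
        push_cast
        ring_nf

/-- The numbers `0` and those that occur as values of the game `v`. -/
noncomputable def Game.payoffs {n : ℕ} (v : Game n) : Finset ℝ :=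
  insert 0 (Finset.univ.image v)

theorem TaskGame.card_payoffs_value_le {n k : ℕ} (G : TaskGame n k) :
    G.value.payoffs.card ≤ k + 1 := by
  have hsub : G.value.payoffs ⊆ insert 0 (Finset.univ.image G.payoff) := by
    intro x hx
    simp only [Game.payoffs, Finset.mem_insert, Finset.mem_image, Finset.mem_univ, true_and] at hx ⊢
    rcases hx with rfl | ⟨S, rfl⟩
    · exact .inl rfl
    · exact (G.value_eq_zero_or S).imp_right fun ⟨t, _, ht⟩ => ⟨t, ht⟩
  calc _ ≤ _ := Finset.card_le_card hsub
    _ ≤ (Finset.univ.image G.payoff).card + 1 := Finset.card_insert_le _ _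
    _ ≤ k + 1 := by
        gcongr
        simpa using Finset.card_image_le (s := Finset.univ) (f := G.payoff)

theorem Game.observed_sample_mem_payoffs {n m : ℕ} (v : Game n) (S : Fin m → Finset (Fin n))
    (j : ℕ) : (v.sample S).observed j ∈ v.payoffs := by
  rcases (v.sample S).observed_eq_zero_or j with h | ⟨i, h⟩
  · simp [h, Game.payoffs]
  · simp [← h, Game.payoffs, Game.sample]

theorem pacLearnable_signedTaskGames (k : ℕ) (pos : Bool) :
    PACLearnable (signedTaskGames k pos) := by
  -- Occam's bound `1 / ε * (K + 1 / δ)`, with `K` the exponent in `card_taskGamesWithPayoffs_le`.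
  refine ⟨consistentLearner k pos, MvPolynomial.X 1 *
    (MvPolynomial.C (k : ℝ) * (MvPolynomial.X 0 ^ 2 + 2 * MvPolynomial.X 0 + 2) +
      MvPolynomial.C (k : ℝ) ^ 2 + MvPolynomial.X 2),
    ⟨searchFit k pos, partrec_searchFit k pos, ?_⟩, ?_⟩
  · intro n v hv m S
    obtain ⟨o, ho, hL, -⟩ := exists_consistentLearner_eq hv S
    exact ⟨o, ho, hL⟩
  · intro n v hv
    have hs : ∀ m (S : Fin m → Finset (Fin n)) i, 0 ≤ (v.sample S i).2 := by
      obtain ⟨G, -, rfl⟩ := hv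
      exact fun m S i => G.value_nonneg _
    refine ⟨fun m S => ?_, fun D hD ε δ hε hδ m hm => ?_⟩
    · obtain ⟨o, -, hL, hfit⟩ := exists_consistentLearner_eq hv S
      obtain ⟨⟨hk, hpos⟩, -⟩ := (Sample.fits_encode_iff (hs m S)).1 hfit
      refine ⟨(v.sample S).taskGame o hk, hpos.imp_right fun h i => ?_,
        hL ▸ Sample.value_taskGame _ _ _⟩
      change 0 ≤ o.1.getD i 0
      -- The length of the weight list is unconstrained; a missing weight reads as `0`, which is
      -- also nonnegative.
      rw [List.getD_eq_getElem?_getD]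
      by_cases hi : (i : ℕ) < o.1.length
      · simpa [hi] using h _ (List.getElem_mem hi)
      · simp [hi]
    · have hcard : v.payoffs.card ≤ k + 1 := by
        obtain ⟨G, -, rfl⟩ := hv
        exact G.card_payoffs_value_le
      -- The hypothesis set may depend on the unknown target: it serves only the analysis, not the
      -- learner.
      refine one_sub_le_prob_error_lt hD v (taskGamesWithPayoffs n k v.payoffs)
        (fun S => consistentLearner k pos n m (v.sample S)) (fun S => ?_) (fun S j => ?_) hε hδ
        (card_taskGamesWithPayoffs_le hcard) ?_
      · obtain ⟨o, -, hL, hfit⟩ := exists_consistentLearner_eq hv S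
        obtain ⟨⟨hk, -⟩, -⟩ := (Sample.fits_encode_iff (hs m S)).1 hfit
        rw [hL, ← Sample.value_taskGame _ o hk]
        exact TaskGame.value_mem_taskGamesWithPayoffs _ fun t =>
          v.observed_sample_mem_payoffs S _
      · obtain ⟨o, -, hL, hfit⟩ := exists_consistentLearner_eq hv S
        rw [hL]
        exact ((Sample.fits_encode_iff (hs m S)).1 hfit).2 j
      · simpa using hm

theorem theorem4 (k : ℕ) :
    PACLearnable (taskGames k) ∧ PACLearnable (nonnegTaskGames k) := by
  have h := pacLearnable_signedTaskGames k
  have h0 : signedTaskGames k false = taskGames k := by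
    funext n
    simp [signedTaskGames, taskGames]
  have h1 : signedTaskGames k true = nonnegTaskGames k := by
    funext n
    simp [signedTaskGames, nonnegTaskGames]
  exact ⟨h0 ▸ h false, h1 ▸ h true⟩
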